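/- Every nonzero ordinal $\alpha$ has a unique Cantor normal form $\alpha=\omega^{\xi_k}r_k+\dots+\omega^{\xi_0}r_0$ with ordinals $\xi_k>\dots>\xi_0$ and integers $k\ge 0$, $r_k,\dots,r_0>0$; let $d(\alpha)=\xi_k$ denote its largest exponent. Let $\alpha\mathbin{\sharp}\beta$ be the natural (Hessenberg) sum, obtained by adding the Cantor normal forms of $\alpha$ and $\beta$ as polynomials in $\omega$, and let $\alpha\otimes\beta$ be the natural (Hessenberg) product, obtained by multiplying the Cantor normal forms using $\omega^{\xi}\otimes\omega^{\eta}=\omega^{\xi\sharp\eta}$ and bilinearity. Sums, products (written $\cdot$) and powers are otherwise the usual ordinal ones. For a sequence $(\alpha_i)_{i<\omega}$ of ordinals, the infinite natural product $\bigotimes_{i<\omega}\alpha_i$ (respectively, the classical infinite ordinal product $\prod_{i<\omega}\alpha_i$) is $0$ if some $\alpha_i$ is $0$, and otherwise it is the supremum over $n<\omega$ of the partial products $\alpha_0\otimes\dots\otimes\alpha_{n-1}$ (respectively, $\alpha_0\cdot\ldots\cdot\alpha_{n-1}$). Empty products are $1$ and empty sums are $0$; $\bigotimes_{n\le i<\omega}\alpha_i$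 and $\prod_{n\le i<\omega}\alpha_i$ are the corresponding products of the sequence $(\alpha_{n+i})_{i<\omega}$. **Corollary.** For every sequence $(\alpha_i)_{i<\omega}$ of ordinals there is $m<\omega$ such that, for every $n\ge m$, $$\bigotimes_{n\le i<\omega}\alpha_i=\prod_{n\le i<\omega}\alpha_i$$ and $$\bigotimes_{i<\omega}\alpha_i=(\alpha_0\otimes\dots\otimes\alpha_{n-1})\cdot\bigotimes_{n\le i<\omega}\alpha_i=(\alpha_0\otimes\dots\otimes\alpha_{n-1})\cdot\prod_{n\le i<\omega}\alpha_i ,$$ and if, moreover, every $\alpha_i$ is nonzero and the sequence is not eventually $1$, then $$\bigotimes_{i<\omega}\alpha_i=\omega^{d(\alpha_0)\sharp\dots\sharp d(\alpha_{n-1})}\cdot\bigotimes_{n\le i<\omega}\alpha_i=\omega^{d(\alpha_0)\sharp\dots\sharp d(\alpha_{n-1})}\cdot\prod_{n\le i<\omega}\alpha_i .$$ -/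

import Mathlib

universe u

namespace OrdNat

/-- The coefficients of the Cantor normal form (base `ω`) of `a`, as natural numbers:
`cnfCoeff a ξ` is the coefficient of `ω ^ ξ`, which is `0` when `ξ` is not an exponent of `a`. -/
noncomputable def cnfCoeff (a : Ordinal.{u}) : Ordinal.{u} →₀ ℕ :=
  (Ordinal.CNF.coeff Ordinal.omega0 a).mapRange (fun o => Cardinal.toNat o.card) (by simp)

/-- The ordinal `ω ^ ξ_k * r_k + ⋯ + ω ^ ξ_0 * r_0` (exponents in decreasing order) with the
prescribed coefficients. -/
noncomputable def ofCoeff (f : Ordinal.{u} →₀ ℕ) : Ordinal.{u} :=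
  Ordinal.CNF.eval Ordinal.omega0 (f.mapRange (fun n : ℕ => (n : Ordinal.{u})) Nat.cast_zero)

/-- Passing from ordinal coefficients to natural numbers loses nothing. -/
theorem cast_cnfCoeff (a e : Ordinal.{u}) :
    (cnfCoeff a e : Ordinal.{u}) = Ordinal.CNF.coeff Ordinal.omega0 a e := by
  have h : Ordinal.CNF.coeff Ordinal.omega0 a e < Ordinal.omega0 := by
    by_cases he : e ∈ (Ordinal.CNF Ordinal.omega0 a).map Prod.fst
    · obtain ⟨⟨e', c⟩, hx, rfl⟩ := List.mem_map.1 he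
      rw [Ordinal.CNF.coeff_of_mem_CNF hx]
      exact Ordinal.CNF.snd_lt Ordinal.one_lt_omega0 hx
    · rw [Ordinal.CNF.coeff_of_notMem_CNF he]
      exact Ordinal.omega0_pos
  obtain ⟨n, hn⟩ := Ordinal.lt_omega0.1 h
  simp [cnfCoeff, hn]

theorem ofCoeff_cnfCoeff (a : Ordinal.{u}) : ofCoeff (cnfCoeff a) = a := by
  have h : (cnfCoeff a).mapRange (fun n : ℕ => (n : Ordinal.{u})) Nat.cast_zero
      = Ordinal.CNF.coeff Ordinal.omega0 a := by
    ext e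
    simpa using cast_cnfCoeff a e
  rw [ofCoeff, h, Ordinal.CNF.eval_coeff]

theorem cnfCoeff_ofCoeff (f : Ordinal.{u} →₀ ℕ) : cnfCoeff (ofCoeff f) = f := by
  ext e
  apply Nat.cast_injective (R := Ordinal.{u})
  rw [cast_cnfCoeff, ofCoeff, Ordinal.CNF.coeff_eval Ordinal.one_lt_omega0]
  · simp
  · intro e
    simpa using Ordinal.natCast_lt_omega0 _

/-- Natural (Hessenberg) sum: add the Cantor normal forms as polynomials in `ω`. -/
noncomputable def nadd (a b : Ordinal.{u}) : Ordinal.{u} :=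
  ofCoeff (cnfCoeff a + cnfCoeff b)

/-- Natural (Hessenberg) product: multiply the Cantor normal forms as polynomials in `ω`, by the
rule `ω ^ ξ ⊗ ω ^ η = ω ^ (nadd ξ η)` and bilinearity. -/
noncomputable def nmul (a b : Ordinal.{u}) : Ordinal.{u} :=
  ofCoeff ((cnfCoeff a).sum fun ξ r => (cnfCoeff b).sum fun η s =>
    Finsupp.single (nadd ξ η) (r * s))

/-- The degree of a nonzero ordinal: the largest exponent of its Cantor normal form
(junk value `0` at `0`). -/
noncomputable def degree (a : Ordinal.{u}) : Ordinal.{u} :=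
  Ordinal.log Ordinal.omega0 a

theorem degree_isGreatest {a : Ordinal.{u}} (ha : a ≠ 0) :
    IsGreatest {ξ | cnfCoeff a ξ ≠ 0} (degree a) := by
  have key : ∀ ξ, cnfCoeff a ξ ≠ 0 ↔ ξ ∈ (Ordinal.CNF Ordinal.omega0 a).map Prod.fst := by
    intro ξ
    rw [← Nat.cast_ne_zero (R := Ordinal.{u}), cast_cnfCoeff, ← Finsupp.mem_support_iff,
      Ordinal.CNF.support_coeff, List.mem_toFinset]
  constructor
  · rw [Set.mem_ofPred_eq, key, Ordinal.CNF.ne_zero ha]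
    simp [degree]
  · intro ξ hξ
    rw [Set.mem_ofPred_eq, key] at hξ
    obtain ⟨x, hx, rfl⟩ := List.mem_map.1 hξ
    exact Ordinal.CNF.fst_le_log hx

/-- `a 0 ♯ ⋯ ♯ a (n - 1)`, with value `0` for `n = 0`. -/
noncomputable def finNatSum (a : ℕ → Ordinal.{u}) : ℕ → Ordinal.{u}
  | 0 => 0
  | n + 1 => nadd (finNatSum a n) (a n)

/-- `a 0 ⊗ ⋯ ⊗ a (n - 1)`, with value `1` for `n = 0`. -/
noncomputable def finNatProd (a : ℕ → Ordinal.{u}) : ℕ → Ordinal.{u}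
  | 0 => 1
  | n + 1 => nmul (finNatProd a n) (a n)

/-- The ordinary ordinal product `a 0 * ⋯ * a (n - 1)`, with value `1` for `n = 0`. -/
noncomputable def finProd (a : ℕ → Ordinal.{u}) : ℕ → Ordinal.{u}
  | 0 => 1
  | n + 1 => finProd a n * a n

open Classical in
/-- The infinite natural product, the limit of the partial natural products: `0` if some factor
is `0`, and the supremum of the partial natural products otherwise. -/
noncomputable def infNatProd (a : ℕ → Ordinal.{u}) : Ordinal.{u} :=
  if ∃ i, a i = 0 then 0 else ⨆ n, finNatProd a n

open Classical in
/-- The classical infinite ordinal product, the limit of the partial ordinal products: `0` if some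
factor is `0`, and the supremum of the partial ordinal products otherwise. -/
noncomputable def infProd (a : ℕ → Ordinal.{u}) : Ordinal.{u} :=
  if ∃ i, a i = 0 then 0 else ⨆ n, finProd a n

/-- The tail `(a n, a (n + 1), …)` of a sequence. -/
def tail (a : ℕ → Ordinal.{u}) (n : ℕ) : ℕ → Ordinal.{u} := fun i => a (n + i)

end OrdNat

namespace OrdNat

open Ordinal

/-! ### Comparing Cantor normal forms coefficientwise -/

/-! Suppose all factors are nonzero and infinitely many differ from 1. Let `e` be least such that
eventually `a i < ω ^ ω ^ e`, and cut at any `n` past which this holds. Write `P` for the natural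
product of the first `n` factors and `D` for its degree, the natural sum of their degrees. Upper
bound: the later degrees lie below `ω ^ e`, which is closed under natural sums, and adding them
naturally to `D` stays below `D + ω ^ e` (`nadd_lt_add_opow`). So every partial natural product is
below `ω ^ D * ω ^ ω ^ e`. Lower bound: by minimality of `e`, the ordinary partial products of the
tail are cofinal in `ω ^ ω ^ e` (`exists_le_finProd`). As ordinary products never exceed natural
ones (`mul_le_nmul`), the infinite product is at least `P * ω ^ ω ^ e ≥ ω ^ D * ω ^ ω ^ e`. Hence
all three agree, and both products of the tail equal `ω ^ ω ^ e`. Sequences that are eventually 1 or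
contain 0 are treated directly. -/

theorem ofCoeff_add_of_le {f g : Ordinal.{u} →₀ ℕ}
    (h : ∀ e₁ ∈ f.support, ∀ e₂ ∈ g.support, e₂ ≤ e₁) :
    ofCoeff (f + g) = ofCoeff f + ofCoeff g := by
  unfold ofCoeff
  rw [Finsupp.mapRange_add (fun x y => Nat.cast_add x y)]
  apply CNF.eval_add
  intro e₁ h₁ e₂ h₂
  exact h e₁ (by simpa using h₁) e₂ (by simpa using h₂)

theorem ofCoeff_single (e : Ordinal.{u}) (n : ℕ) :
    ofCoeff (Finsupp.single e n) = ω ^ e * n := by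
  simp [ofCoeff]

theorem ofCoeff_zero : ofCoeff (0 : Ordinal.{u} →₀ ℕ) = 0 := by
  simp [ofCoeff]

theorem cnfCoeff_zero : cnfCoeff (0 : Ordinal.{u}) = 0 := by
  rw [← ofCoeff_zero, cnfCoeff_ofCoeff]

theorem cnfCoeff_opow_mul (e : Ordinal.{u}) (n : ℕ) :
    cnfCoeff (ω ^ e * n) = Finsupp.single e n := by
  rw [← ofCoeff_single, cnfCoeff_ofCoeff]

theorem cnfCoeff_opow (e : Ordinal.{u}) : cnfCoeff (ω ^ e) = Finsupp.single e 1 := by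
  simpa using cnfCoeff_opow_mul e 1

theorem cnfCoeff_one : cnfCoeff (1 : Ordinal.{u}) = Finsupp.single 0 1 := by
  simpa using cnfCoeff_opow 0

theorem ofCoeff_lt_opow {f : Ordinal.{u} →₀ ℕ} {e : Ordinal.{u}}
    (h : ∀ e', e ≤ e' → f e' = 0) : ofCoeff f < ω ^ e := by
  apply CNF.eval_lt
  · intro e'
    simp
  · intro e' he'
    by_contra hlt
    have := h e' (not_lt.1 hlt)
    simp [this] at he'

theorem cnfCoeff_eq_zero_of_lt {a e : Ordinal.{u}} (h : a < ω ^ e) : cnfCoeff a e = 0 := by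
  apply Nat.cast_injective (R := Ordinal.{u})
  rw [cast_cnfCoeff, CNF.coeff_eq_zero_of_lt h, Nat.cast_zero]

theorem ofCoeff_eq_filter_add (f : Ordinal.{u} →₀ ℕ) (e : Ordinal.{u}) :
    ofCoeff f = ofCoeff (f.filter (e ≤ ·)) + ofCoeff (f.filter (¬ e ≤ ·)) := by
  classical
  conv_lhs => rw [← Finsupp.filter_add_filter_not f (e ≤ ·)]
  apply ofCoeff_add_of_le
  intro e₁ h₁ e₂ h₂
  simp only [Finsupp.support_filter, Finset.mem_filter] at h₁ h₂
  exact (not_le.1 h₂.2).le.trans h₁.2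

theorem ofCoeff_filter_not_le_lt (f : Ordinal.{u} →₀ ℕ) (e : Ordinal.{u}) :
    ofCoeff (f.filter (¬ e ≤ ·)) < ω ^ e := by
  apply ofCoeff_lt_opow
  intro e' he'
  simp [he']

theorem ofCoeff_filter_le (f : Ordinal.{u} →₀ ℕ) (e : Ordinal.{u}) :
    ofCoeff (f.filter (e ≤ ·)) = ofCoeff (f.filter (e < ·)) + ω ^ e * f e := by
  have h : f.filter (e ≤ ·) = f.filter (e < ·) + Finsupp.single e (f e) := by
    ext x
    rcases lt_trichotomy e x with hx | rfl | hx
    · simp [hx, hx.le, hx.ne]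
    · simp
    · simp [hx.not_ge, hx.le, hx.ne']
  rw [h, ofCoeff_add_of_le, ofCoeff_single]
  intro e₁ h₁ e₂ h₂
  have h₂' := Finsupp.support_single_subset h₂
  simp only [Finsupp.support_filter, Finset.mem_filter, Finset.mem_singleton] at h₁ h₂'
  exact h₂' ▸ h₁.2.le

/-- The common terms above `e` cancel, and all terms of `f` below `e` together are less than one
further copy of `ω ^ e`. -/
theorem ofCoeff_lt_ofCoeff {f g : Ordinal.{u} →₀ ℕ} {e : Ordinal.{u}} (he : f e < g e)
    (h : ∀ e', e < e' → f e' = g e') : ofCoeff f < ofCoeff g := by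
  have hfg : f.filter (e < ·) = g.filter (e < ·) := by
    ext x
    by_cases hx : e < x
    · simp [hx, h x hx]
    · simp [hx]
  rw [ofCoeff_eq_filter_add f e, ofCoeff_eq_filter_add g e, ofCoeff_filter_le,
    ofCoeff_filter_le g, hfg, add_assoc, add_assoc]
  gcongr
  calc ω ^ e * (f e : Ordinal) + ofCoeff (f.filter (¬ e ≤ ·))
      < ω ^ e * (f e : Ordinal) + ω ^ e := by
        gcongr
        exact ofCoeff_filter_not_le_lt f e
    _ = ω ^ e * ((f e + 1 : ℕ) : Ordinal) := by rw [Nat.cast_succ, mul_add_one]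
    _ ≤ ω ^ e * (g e : Ordinal) := by
        gcongr
        exact he
    _ ≤ _ := le_self_add

theorem exists_cnfCoeff_lt {a b : Ordinal.{u}} (h : a < b) :
    ∃ e, cnfCoeff a e < cnfCoeff b e ∧ ∀ e', e < e' → cnfCoeff a e' = cnfCoeff b e' := by
  classical
  have hne : cnfCoeff a ≠ cnfCoeff b := fun hab =>
    h.ne (by rw [← ofCoeff_cnfCoeff a, hab, ofCoeff_cnfCoeff])
  obtain ⟨e, he, hmax⟩ := Finset.exists_max_image ((cnfCoeff a).neLocus (cnfCoeff b)) id
    (Finsupp.nonempty_neLocus_iff.2 hne)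
  have habove : ∀ e', e < e' → cnfCoeff a e' = cnfCoeff b e' := by
    intro e' he'
    by_contra hcon
    exact (hmax e' (Finsupp.mem_neLocus.2 hcon)).not_gt he'
  refine ⟨e, (Finsupp.mem_neLocus.1 he).lt_of_le (not_lt.1 fun hlt => ?_), habove⟩
  have := ofCoeff_lt_ofCoeff hlt fun e' he' => (habove e' he').symm
  rw [ofCoeff_cnfCoeff, ofCoeff_cnfCoeff] at this
  exact this.not_gt h

/-! ### Natural sums -/

theorem cnfCoeff_nadd (a b : Ordinal.{u}) : cnfCoeff (nadd a b) = cnfCoeff a + cnfCoeff b :=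
  cnfCoeff_ofCoeff _

theorem cnfCoeff_injective : Function.Injective (cnfCoeff : Ordinal.{u} → _) :=
  Function.LeftInverse.injective ofCoeff_cnfCoeff

theorem nadd_comm (a b : Ordinal.{u}) : nadd a b = nadd b a := by
  rw [nadd, add_comm, nadd]

theorem nadd_assoc (a b c : Ordinal.{u}) : nadd (nadd a b) c = nadd a (nadd b c) :=
  cnfCoeff_injective (by simp only [cnfCoeff_nadd, add_assoc])

theorem nadd_zero (a : Ordinal.{u}) : nadd a 0 = a := by
  rw [nadd, cnfCoeff_zero, add_zero, ofCoeff_cnfCoeff]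

theorem nadd_strictMono (a : Ordinal.{u}) : StrictMono (nadd a) := by
  intro b c h
  obtain ⟨e, he, habove⟩ := exists_cnfCoeff_lt h
  apply ofCoeff_lt_ofCoeff (e := e)
  · simpa using he
  · intro e' he'
    simp [habove e' he']

theorem nadd_le_nadd {a b c d : Ordinal.{u}} (hab : a ≤ b) (hcd : c ≤ d) :
    nadd a c ≤ nadd b d := by
  refine ((nadd_strictMono a).monotone hcd).trans ?_
  rw [nadd_comm a, nadd_comm b]
  exact (nadd_strictMono d).monotone hab

theorem add_le_nadd (a b : Ordinal.{u}) : a + b ≤ nadd a b := by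
  induction b using WellFoundedLT.induction with
  | ind b ih =>
    apply le_of_forall_lt
    intro x hx
    rcases lt_or_ge x a with hxa | hxa
    · exact hxa.trans_le (by simpa only [nadd_zero] using (nadd_strictMono a).monotone (zero_le (a := b)))
    · obtain ⟨c, rfl⟩ := exists_add_of_le hxa
      have hc : c < b := by simpa using hx
      exact (ih c hc).trans_lt (nadd_strictMono a hc)

theorem nadd_one (a : Ordinal.{u}) : nadd a 1 = a + 1 := by
  rw [nadd, cnfCoeff_one, ofCoeff_add_of_le, ofCoeff_cnfCoeff, ofCoeff_single]
  · simp
  · intro e₁ _ e₂ h₂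
    have := Finsupp.support_single_subset h₂
    simp_all

/-- Adding `b` changes only coefficients at exponents below `e`, so the part at exponents at least
`e` is that of `a`, and the rest is below `ω ^ e`. -/
theorem nadd_lt_add_opow {a b e : Ordinal.{u}} (h : b < ω ^ e) : nadd a b < a + ω ^ e := by
  have hb : ∀ e', e ≤ e' → cnfCoeff b e' = 0 := fun e' he' =>
    cnfCoeff_eq_zero_of_lt (h.trans_le (opow_le_opow_right omega0_pos he'))
  have hfilter : (cnfCoeff a + cnfCoeff b).filter (e ≤ ·) = (cnfCoeff a).filter (e ≤ ·) := by
    ext x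
    by_cases hx : e ≤ x
    · simp [hx, hb x hx]
    · simp [hx]
  rw [nadd, ofCoeff_eq_filter_add _ e, hfilter]
  calc _ < ofCoeff ((cnfCoeff a).filter (e ≤ ·)) + ω ^ e := by
        gcongr
        exact ofCoeff_filter_not_le_lt _ e
    _ ≤ a + ω ^ e := by
        gcongr
        conv_rhs => rw [← ofCoeff_cnfCoeff a, ofCoeff_eq_filter_add _ e]
        exact le_self_add

theorem nadd_lt_opow {a b e : Ordinal.{u}} (ha : a < ω ^ e) (hb : b < ω ^ e) :
    nadd a b < ω ^ e :=
  (nadd_lt_add_opow hb).trans_eq (add_omega0_opow ha)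

/-! ### Natural products -/

theorem cnfCoeff_nmul_apply (a b x : Ordinal.{u}) :
    cnfCoeff (nmul a b) x = (cnfCoeff a).sum fun ξ r => (cnfCoeff b).sum fun η s =>
      Finsupp.single (nadd ξ η) (r * s) x := by
  rw [nmul, cnfCoeff_ofCoeff, Finsupp.sum_apply]
  simp only [Finsupp.sum_apply]

theorem nmul_zero (a : Ordinal.{u}) : nmul a 0 = 0 := by
  simp [nmul, cnfCoeff_zero, ofCoeff_zero]

theorem zero_nmul (a : Ordinal.{u}) : nmul 0 a = 0 := by
  simp [nmul, cnfCoeff_zero, ofCoeff_zero]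

theorem nmul_one (a : Ordinal.{u}) : nmul a 1 = a := by
  rw [nmul, cnfCoeff_one]
  conv_rhs => rw [← ofCoeff_cnfCoeff a, ← Finsupp.sum_single (cnfCoeff a)]
  congr 2
  ext1 ξ
  ext1 r
  rw [Finsupp.sum_single_index (by simp), nadd_zero, mul_one]

theorem nmul_nadd (a b c : Ordinal.{u}) :
    nmul a (nadd b c) = nadd (nmul a b) (nmul a c) := by
  apply cnfCoeff_injective
  rw [cnfCoeff_nadd]
  simp only [nmul, cnfCoeff_ofCoeff, cnfCoeff_nadd]
  rw [← Finsupp.sum_add]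
  congr 1
  ext1 ξ
  ext1 r
  apply Finsupp.sum_add_index'
  · simp
  · simp [mul_add]

theorem exists_of_cnfCoeff_nmul_ne_zero {a b x : Ordinal.{u}} (h : cnfCoeff (nmul a b) x ≠ 0) :
    ∃ ξ η, cnfCoeff a ξ ≠ 0 ∧ cnfCoeff b η ≠ 0 ∧ nadd ξ η = x := by
  rw [cnfCoeff_nmul_apply] at h
  obtain ⟨ξ, hξ, h⟩ := Finset.exists_ne_zero_of_sum_ne_zero h
  obtain ⟨η, hη, h⟩ := Finset.exists_ne_zero_of_sum_ne_zero h
  refine ⟨ξ, η, Finsupp.mem_support_iff.1 hξ, Finsupp.mem_support_iff.1 hη, ?_⟩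
  by_contra hne
  exact h (Finsupp.single_eq_of_ne' hne)

theorem cnfCoeff_nmul_nadd_ne_zero {a b ξ η : Ordinal.{u}} (hξ : cnfCoeff a ξ ≠ 0)
    (hη : cnfCoeff b η ≠ 0) : cnfCoeff (nmul a b) (nadd ξ η) ≠ 0 := by
  rw [cnfCoeff_nmul_apply]
  intro h
  have h₁ := Finset.sum_eq_zero_iff.1 h ξ (Finsupp.mem_support_iff.2 hξ)
  have h₂ := Finset.sum_eq_zero_iff.1 h₁ η (Finsupp.mem_support_iff.2 hη)
  simp [hξ, hη] at h₂

theorem nmul_ne_zero {a b : Ordinal.{u}} (ha : a ≠ 0) (hb : b ≠ 0) : nmul a b ≠ 0 := by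
  intro h
  have := cnfCoeff_nmul_nadd_ne_zero (degree_isGreatest ha).1 (degree_isGreatest hb).1
  simp [h, cnfCoeff_zero] at this

theorem degree_nmul {a b : Ordinal.{u}} (ha : a ≠ 0) (hb : b ≠ 0) :
    degree (nmul a b) = nadd (degree a) (degree b) := by
  refine (degree_isGreatest (nmul_ne_zero ha hb)).unique ⟨?_, ?_⟩
  · exact cnfCoeff_nmul_nadd_ne_zero (degree_isGreatest ha).1 (degree_isGreatest hb).1
  · intro x hx
    obtain ⟨ξ, η, hξ, hη, rfl⟩ := exists_of_cnfCoeff_nmul_ne_zero hx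
    exact nadd_le_nadd ((degree_isGreatest ha).2 hξ) ((degree_isGreatest hb).2 hη)

theorem lt_opow_iff_degree_lt {a e : Ordinal.{u}} (ha : a ≠ 0) : a < ω ^ e ↔ degree a < e :=
  lt_opow_iff_log_lt one_lt_omega0 ha

theorem nmul_lt_nmul_opow {a b e : Ordinal.{u}} (ha : a ≠ 0) (h : b < ω ^ e) :
    nmul a b < nmul a (ω ^ e) := by
  have he : ω ^ e ≠ 0 := (opow_pos e omega0_pos).ne'
  rcases eq_or_ne b 0 with rfl | hb
  · rw [nmul_zero]
    exact pos_iff_ne_zero.2 (nmul_ne_zero ha he)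
  · rw [← not_le]
    intro hle
    have := log_mono_right ω hle
    change degree _ ≤ degree _ at this
    rw [degree_nmul ha he, degree_nmul ha hb] at this
    refine this.not_gt (nadd_strictMono _ ?_)
    rw [degree.eq_def (ω ^ e), log_opow one_lt_omega0]
    exact (lt_opow_iff_degree_lt hb).1 h

theorem exists_eq_nadd_of_cnfCoeff_le {a b : Ordinal.{u}} (h : cnfCoeff a ≤ cnfCoeff b) :
    ∃ c, b = nadd a c := by
  obtain ⟨d, hd⟩ := exists_add_of_le h
  exact ⟨ofCoeff d, cnfCoeff_injective (by rw [cnfCoeff_nadd, cnfCoeff_ofCoeff, hd])⟩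

theorem le_nadd_right (a b : Ordinal.{u}) : a ≤ nadd a b :=
  le_self_add.trans (add_le_nadd a b)

/-- At the largest exponent `e` where `b` and `c` differ, `b` is `t` plus terms below `ω ^ e`, while
`c` contains `t ♯ ω ^ e`. Distributivity reduces the claim to a comparison of degrees. -/
theorem nmul_strictMono {a : Ordinal.{u}} (ha : a ≠ 0) : StrictMono (nmul a) := by
  intro b c h
  obtain ⟨e, he, habove⟩ := exists_cnfCoeff_lt h
  obtain ⟨t, ht⟩ : ∃ t, cnfCoeff t = (cnfCoeff b).filter (e ≤ ·) := ⟨_, cnfCoeff_ofCoeff _⟩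
  have hb : b = nadd t (ofCoeff ((cnfCoeff b).filter (¬ e ≤ ·))) := by
    apply cnfCoeff_injective
    rw [cnfCoeff_nadd, ht, cnfCoeff_ofCoeff, Finsupp.filter_add_filter_not]
  obtain ⟨d, hd⟩ : ∃ d, c = nadd (nadd t (ω ^ e)) d := by
    apply exists_eq_nadd_of_cnfCoeff_le
    rw [cnfCoeff_nadd, ht, cnfCoeff_opow]
    intro x
    rcases lt_trichotomy e x with hx | rfl | hx
    · simp [hx.le, hx.ne, habove x hx]
    -- The strict inequality of coefficients at `e` leaves room for the extra `ω ^ e`.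
    · simpa using he
    · simp [hx.not_ge, hx.ne']
  calc nmul a b = nadd (nmul a t) (nmul a (ofCoeff ((cnfCoeff b).filter (¬ e ≤ ·)))) := by
        rw [← nmul_nadd, ← hb]
    _ < nadd (nmul a t) (nmul a (ω ^ e)) :=
        nadd_strictMono _ (nmul_lt_nmul_opow ha (ofCoeff_filter_not_le_lt _ e))
    _ = nmul a (nadd t (ω ^ e)) := (nmul_nadd _ _ _).symm
    _ ≤ nadd (nmul a (nadd t (ω ^ e))) (nmul a d) := le_nadd_right _ _
    _ = nmul a c := by rw [← nmul_nadd, ← hd]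

/-- Induction on `b`: dividing `x < a * b` by `a` gives a quotient `q < b`, and `x < a * q + a ≤ a ⊗
(q + 1)`. -/
theorem mul_le_nmul (a b : Ordinal.{u}) : a * b ≤ nmul a b := by
  rcases eq_or_ne a 0 with rfl | ha
  · simp
  induction b using WellFoundedLT.induction with
  | ind b ih =>
    apply le_of_forall_lt
    intro x hx
    have hq : x / a < b := (lt_mul_iff_div_lt ha).1 hx
    calc x = a * (x / a) + x % a := (div_add_mod x a).symm
      _ < a * (x / a) + a := by
          gcongr
          exact mod_lt x ha
      _ ≤ nmul a (x / a) + a := by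
          gcongr
          exact ih _ hq
      _ ≤ nadd (nmul a (x / a)) a := add_le_nadd _ _
      _ = nmul a (x / a + 1) := by rw [← nadd_one, nmul_nadd, nmul_one]
      _ ≤ nmul a b := (nmul_strictMono ha).monotone (by simpa using hq)

/-! ### Partial products -/

theorem tail_zero (a : ℕ → Ordinal.{u}) : tail a 0 = a :=
  funext fun i => congrArg a (zero_add i)

theorem tail_tail (a : ℕ → Ordinal.{u}) (m n : ℕ) : tail (tail a m) n = tail a (m + n) :=
  funext fun i => congrArg a (add_assoc m n i).symm

theorem finNatSum_add (d : ℕ → Ordinal.{u}) (n k : ℕ) :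
    finNatSum d (n + k) = nadd (finNatSum d n) (finNatSum (tail d n) k) := by
  induction k with
  | zero => exact (nadd_zero _).symm
  | succ k ih => rw [← add_assoc, finNatSum, ih, nadd_assoc]; rfl

theorem finNatSum_lt_opow {d : ℕ → Ordinal.{u}} {e : Ordinal.{u}} (h : ∀ i, d i < ω ^ e) (k : ℕ) :
    finNatSum d k < ω ^ e := by
  induction k with
  | zero => exact opow_pos e omega0_pos
  | succ k ih => exact nadd_lt_opow ih (h k)

theorem finNatProd_mul_finProd_le (a : ℕ → Ordinal.{u}) (n k : ℕ) :
    finNatProd a n * finProd (tail a n) k ≤ finNatProd a (n + k) := by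
  induction k with
  | zero => simp [finProd]
  | succ k ih =>
    rw [finProd, ← mul_assoc, ← add_assoc, finNatProd]
    exact (mul_le_mul_left ih _).trans (mul_le_nmul _ _)

theorem finProd_le_finNatProd (a : ℕ → Ordinal.{u}) (k : ℕ) : finProd a k ≤ finNatProd a k := by
  simpa [tail_zero, finNatProd] using finNatProd_mul_finProd_le a 0 k

theorem finNatProd_eq_zero {a : ℕ → Ordinal.{u}} {i n : ℕ} (hi : a i = 0) (hn : i < n) :
    finNatProd a n = 0 := by
  induction n, hn using Nat.le_induction with
  | base => rw [finNatProd, hi, nmul_zero]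
  | succ n _ ih => rw [finNatProd, ih, zero_nmul]

theorem finProd_eq_one {a : ℕ → Ordinal.{u}} (h : ∀ i, a i = 1) (k : ℕ) :
    finProd a k = 1 := by
  induction k with
  | zero => rfl
  | succ k ih => rw [finProd, ih, h, mul_one]

theorem finNatProd_add_of_eq_one {a : ℕ → Ordinal.{u}} {n : ℕ} (h : ∀ i, n ≤ i → a i = 1)
    (k : ℕ) : finNatProd a (n + k) = finNatProd a n := by
  induction k with
  | zero => rfl
  | succ k ih => rw [← add_assoc, finNatProd, ih, h _ (Nat.le_add_right n k), nmul_one]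

theorem infNatProd_eq_zero {a : ℕ → Ordinal.{u}} {i : ℕ} (h : a i = 0) : infNatProd a = 0 :=
  if_pos ⟨i, h⟩

theorem infProd_eq_zero {a : ℕ → Ordinal.{u}} {i : ℕ} (h : a i = 0) : infProd a = 0 :=
  if_pos ⟨i, h⟩

section Nonzero

variable {a : ℕ → Ordinal.{u}} (ha : ∀ i, a i ≠ 0)
include ha

theorem infNatProd_eq_iSup : infNatProd a = ⨆ n, finNatProd a n :=
  if_neg (not_exists.2 ha)

theorem infProd_eq_iSup : infProd a = ⨆ n, finProd a n :=
  if_neg (not_exists.2 ha)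

theorem finNatProd_ne_zero (n : ℕ) : finNatProd a n ≠ 0 := by
  induction n with
  | zero => exact one_ne_zero
  | succ n ih => exact nmul_ne_zero ih (ha n)

theorem degree_finNatProd (n : ℕ) :
    degree (finNatProd a n) = finNatSum (fun i => degree (a i)) n := by
  induction n with
  | zero => exact log_one_right ω
  | succ n ih => rw [finNatProd, degree_nmul (finNatProd_ne_zero ha n) (ha n), ih, finNatSum]

theorem finNatProd_monotone : Monotone (finNatProd a) :=
  monotone_nat_of_le_succ fun n =>
    (le_mul_of_one_le_right' (Order.one_le_iff_pos.2 (pos_iff_ne_zero.2 (ha n)))).trans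
      (mul_le_nmul _ _)

theorem finProd_monotone : Monotone (finProd a) :=
  monotone_nat_of_le_succ fun n =>
    le_mul_of_one_le_right' (Order.one_le_iff_pos.2 (pos_iff_ne_zero.2 (ha n)))

theorem exists_pow_le_finProd {c : Ordinal.{u}} (hc : ∃ᶠ i in Filter.atTop, c ≤ a i) (k : ℕ) :
    ∃ n, c ^ k ≤ finProd a n := by
  induction k with
  | zero => exact ⟨0, by simp [finProd]⟩
  | succ k ih =>
    obtain ⟨n, hn⟩ := ih
    obtain ⟨i, hi, hci⟩ := Filter.frequently_atTop.1 hc n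
    refine ⟨i + 1, ?_⟩
    rw [pow_succ, finProd]
    exact mul_le_mul' (hn.trans (finProd_monotone ha hi)) hci

theorem finNatProd_add_lt {e : Ordinal.{u}} {n : ℕ} (h : ∀ i, n ≤ i → a i < ω ^ ω ^ e) (k : ℕ) :
    finNatProd a (n + k) < ω ^ (finNatSum (fun i => degree (a i)) n + ω ^ e) := by
  rw [lt_opow_iff_degree_lt (finNatProd_ne_zero ha _), degree_finNatProd ha, finNatSum_add]
  refine nadd_lt_add_opow (finNatSum_lt_opow (fun i => ?_) k)
  exact (lt_opow_iff_degree_lt (ha _)).1 (h _ (Nat.le_add_right n i))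

/-! ### Infinite products -/

theorem infNatProd_of_cofinal {e : Ordinal.{u}} {n : ℕ} (h : ∀ i, n ≤ i → a i < ω ^ ω ^ e)
    (hcof : ∀ x < ω ^ ω ^ e, ∃ k, x ≤ finProd (tail a n) k) :
    infNatProd a = finNatProd a n * ω ^ ω ^ e ∧
      infNatProd a = ω ^ finNatSum (fun i => degree (a i)) n * ω ^ ω ^ e := by
  have hlim : Order.IsSuccLimit (ω ^ ω ^ e) :=
    isSuccLimit_opow_left isSuccLimit_omega0 (opow_pos e omega0_pos).ne'
  have h₁ : infNatProd a ≤ ω ^ finNatSum (fun i => degree (a i)) n * ω ^ ω ^ e := by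
    rw [infNatProd_eq_iSup ha, ← opow_add]
    exact Ordinal.iSup_le fun j =>
      (finNatProd_monotone ha (Nat.le_add_left j n)).trans (finNatProd_add_lt ha h j).le
  have h₂ : ω ^ finNatSum (fun i => degree (a i)) n * ω ^ ω ^ e ≤ finNatProd a n * ω ^ ω ^ e := by
    rw [← degree_finNatProd ha]
    exact mul_le_mul_left (opow_log_le_self ω (finNatProd_ne_zero ha n)) _
  have h₃ : finNatProd a n * ω ^ ω ^ e ≤ infNatProd a := by
    apply le_of_forall_lt
    intro x hx
    -- Ordinary multiplication is continuous in its right factor at the limit `ω ^ ω ^ e`.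
    obtain ⟨c, hc, hxc⟩ := (lt_mul_iff_of_isSuccLimit hlim).1 hx
    obtain ⟨k, hk⟩ := hcof c hc
    rw [infNatProd_eq_iSup ha]
    exact ((hxc.trans_le (mul_le_mul_right hk _)).trans_le (finNatProd_mul_finProd_le a n k)).trans_le
      (Ordinal.le_iSup _ _)
  exact ⟨(h₁.trans h₂).antisymm h₃, h₁.antisymm (h₂.trans h₃)⟩

theorem infProd_of_cofinal {e : Ordinal.{u}} (h : ∀ i, a i < ω ^ ω ^ e)
    (hcof : ∀ x < ω ^ ω ^ e, ∃ k, x ≤ finProd a k) :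
    infNatProd a = ω ^ ω ^ e ∧ infProd a = ω ^ ω ^ e := by
  have hnat : infNatProd a = ω ^ ω ^ e := by
    simpa [finNatProd] using
      (infNatProd_of_cofinal ha (n := 0) (fun i _ => h i) (by rwa [tail_zero])).1
  refine ⟨hnat, le_antisymm ?_ ?_⟩
  · rw [← hnat, infProd_eq_iSup ha, infNatProd_eq_iSup ha]
    exact Ordinal.iSup_le fun k => (finProd_le_finNatProd a k).trans (Ordinal.le_iSup (finNatProd a) k)
  · have hlim : Order.IsSuccLimit (ω ^ ω ^ e) :=
      isSuccLimit_opow_left isSuccLimit_omega0 (opow_pos e omega0_pos).ne'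
    apply le_of_forall_lt
    intro x hx
    -- Cofinality gives only `≤`, so it is applied to the successor of `x`.
    obtain ⟨k, hk⟩ := hcof _ (hlim.succ_lt hx)
    rw [infProd_eq_iSup ha]
    exact ((Order.lt_succ x).trans_le hk).trans_le (Ordinal.le_iSup (finProd a) k)

/-- Powers of a bound that recurs infinitely often suffice: powers of 2 are cofinal in `ω`, and for
`e ≠ 0` the powers `(ω ^ ω ^ c) ^ j` with `c < e` are cofinal in `ω ^ ω ^ e`. -/
theorem exists_le_finProd {e : Ordinal.{u}} (hone : ¬ ∀ᶠ i in Filter.atTop, a i = 1)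
    (hmin : ∀ c < e, ∃ᶠ i in Filter.atTop, ω ^ ω ^ c ≤ a i) {x : Ordinal.{u}}
    (hx : x < ω ^ ω ^ e) : ∃ k, x ≤ finProd a k := by
  rcases eq_or_ne x 0 with rfl | hx0
  · exact ⟨0, zero_le⟩
  rcases eq_or_ne e 0 with rfl | he
  · rw [opow_zero, opow_one] at hx
    obtain ⟨j, rfl⟩ := lt_omega0.1 hx
    have htwo : ∃ᶠ i in Filter.atTop, 2 ≤ a i := by
      refine (Filter.not_eventually.1 hone).mono fun i hi => ?_
      rw [← one_add_one_eq_two, Order.add_one_le_iff]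
      exact (Order.one_le_iff_pos.2 (pos_iff_ne_zero.2 (ha i))).lt_of_ne' hi
    obtain ⟨n, hn⟩ := exists_pow_le_finProd ha htwo j
    exact ⟨n, le_trans (mod_cast Nat.lt_two_pow_self.le) hn⟩
  · obtain ⟨c, hc, j, hj⟩ := (lt_omega0_opow he).1 ((lt_opow_iff_degree_lt hx0).1 hx)
    obtain ⟨n, hn⟩ := exists_pow_le_finProd ha (hmin c hc) j
    refine ⟨n, le_trans ?_ hn⟩
    rw [← opow_natCast, ← opow_mul]
    exact ((lt_opow_iff_degree_lt hx0).2 hj).le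

theorem exists_infNatProd_eq (hone : ¬ ∀ᶠ i in Filter.atTop, a i = 1) :
    ∃ e : Ordinal.{u}, ∃ m : ℕ, ∀ n, m ≤ n →
      infNatProd (tail a n) = ω ^ ω ^ e ∧ infProd (tail a n) = ω ^ ω ^ e ∧
      infNatProd a = finNatProd a n * ω ^ ω ^ e ∧
      infNatProd a = ω ^ finNatSum (fun i => degree (a i)) n * ω ^ ω ^ e := by
  have hne : {e : Ordinal.{u} | ∀ᶠ i in Filter.atTop, a i < ω ^ ω ^ e}.Nonempty := by
    refine ⟨Order.succ (⨆ i, a i), Filter.Eventually.of_forall fun i => ?_⟩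
    exact ((Order.lt_succ_iff.2 (Ordinal.le_iSup a i)).trans_le
      (right_le_opow _ one_lt_omega0)).trans_le (right_le_opow _ one_lt_omega0)
  set e := sInf {e : Ordinal.{u} | ∀ᶠ i in Filter.atTop, a i < ω ^ ω ^ e} with he
  have hmem : ∀ᶠ i in Filter.atTop, a i < ω ^ ω ^ e := csInf_mem hne
  obtain ⟨m, hm⟩ := Filter.eventually_atTop.1 hmem
  have hmin : ∀ c < e, ∃ᶠ i in Filter.atTop, ω ^ ω ^ c ≤ a i := by
    intro c hc hcon
    exact notMem_of_lt_csInf' hc (hcon.mono fun i hi => not_le.1 hi)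
  refine ⟨e, m, fun n hn => ?_⟩
  -- Transfers the "infinitely often" hypotheses to the tail.
  have htail : Filter.map (fun i => n + i) Filter.atTop = Filter.atTop := by
    simpa only [add_comm] using Filter.map_add_atTop_eq_nat n
  have hlt : ∀ i, n ≤ i → a i < ω ^ ω ^ e := fun i hi => hm i (hn.trans hi)
  have hcof : ∀ x < ω ^ ω ^ e, ∃ k, x ≤ finProd (tail a n) k := by
    intro x hx
    refine exists_le_finProd (fun i => ha _) ?_ (fun c hc => ?_) hx
    · rwa [← htail] at hone
    · have := hmin c hc
      rwa [← htail] at this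
  obtain ⟨h₁, h₂⟩ := infProd_of_cofinal (fun i => ha (n + i))
    (fun i => hlt _ (Nat.le_add_right n i)) hcof
  exact ⟨h₁, h₂, infNatProd_of_cofinal ha hlt hcof⟩

theorem infNatProd_of_eq_one {n : ℕ} (h : ∀ i, n ≤ i → a i = 1) :
    infNatProd a = finNatProd a n := by
  rw [infNatProd_eq_iSup ha]
  refine le_antisymm (Ordinal.iSup_le fun j => ?_) (Ordinal.le_iSup (finNatProd a) n)
  exact (finNatProd_monotone ha (Nat.le_add_left j n)).trans (finNatProd_add_of_eq_one h j).le

end Nonzero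

theorem infNatProd_one {a : ℕ → Ordinal.{u}} (h : ∀ i, a i = 1) : infNatProd a = 1 :=
  infNatProd_of_eq_one (n := 0) (fun i => by simp [h i]) fun i _ => h i

theorem infProd_one {a : ℕ → Ordinal.{u}} (h : ∀ i, a i = 1) : infProd a = 1 := by
  rw [infProd_eq_iSup fun i => by simp [h i]]
  simp [finProd_eq_one h]

theorem exists_infNatProd_tail {a : ℕ → Ordinal.{u}} (ha : ∀ i, a i ≠ 0) :
    ∃ m : ℕ, ∀ n, m ≤ n → infNatProd (tail a n) = infProd (tail a n) ∧
      infNatProd a = finNatProd a n * infNatProd (tail a n) := by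
  by_cases hone : ∀ᶠ i in Filter.atTop, a i = 1
  · obtain ⟨m, hm⟩ := Filter.eventually_atTop.1 hone
    refine ⟨m, fun n hn => ?_⟩
    have h : ∀ i, tail a n i = 1 := fun i => hm _ (hn.trans (Nat.le_add_right n i))
    rw [infNatProd_one h, infProd_one h, mul_one]
    exact ⟨rfl, infNatProd_of_eq_one ha fun i hi => hm i (hn.trans hi)⟩
  · obtain ⟨e, m, hm⟩ := exists_infNatProd_eq ha hone
    refine ⟨m, fun n hn => ?_⟩
    obtain ⟨h₁, h₂, h₃, -⟩ := hm n hn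
    exact ⟨h₁.trans h₂.symm, h₁ ▸ h₃⟩

theorem exists_infNatProd_tail_eq_infProd (a : ℕ → Ordinal.{u}) :
    ∃ m : ℕ, ∀ n, m ≤ n → infNatProd (tail a n) = infProd (tail a n) := by
  by_cases hzero : ∃ᶠ i in Filter.atTop, a i = 0
  -- Every tail contains a zero, so both products vanish.
  · refine ⟨0, fun n _ => ?_⟩
    obtain ⟨i, hi, h⟩ := Filter.frequently_atTop.1 hzero n
    obtain ⟨k, rfl⟩ := Nat.exists_eq_add_of_le hi
    rw [infNatProd_eq_zero (a := tail a n) h, infProd_eq_zero (a := tail a n) h]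
  · obtain ⟨N, hN⟩ := Filter.eventually_atTop.1 (Filter.not_frequently.1 hzero)
    obtain ⟨m, hm⟩ := exists_infNatProd_tail (a := tail a N)
      fun i => hN _ (Nat.le_add_right N i)
    refine ⟨N + m, fun n hn => ?_⟩
    obtain ⟨k, rfl⟩ := Nat.exists_eq_add_of_le hn
    have := (hm (m + k) (Nat.le_add_right m k)).1
    rwa [tail_tail, ← add_assoc] at this

end OrdNat

theorem corollary2p8 (α : ℕ → Ordinal.{u}) :
    ∃ m : ℕ, ∀ n : ℕ, m ≤ n →
      OrdNat.infNatProd (OrdNat.tail α n) = OrdNat.infProd (OrdNat.tail α n) ∧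
      OrdNat.infNatProd α =
        OrdNat.finNatProd α n * OrdNat.infNatProd (OrdNat.tail α n) ∧
      OrdNat.infNatProd α =
        OrdNat.finNatProd α n * OrdNat.infProd (OrdNat.tail α n) ∧
      ((∀ i, α i ≠ 0) → ¬ (∀ᶠ i in Filter.atTop, α i = 1) →
        OrdNat.infNatProd α =
          Ordinal.omega0 ^ OrdNat.finNatSum (fun i => OrdNat.degree (α i)) n *
            OrdNat.infNatProd (OrdNat.tail α n) ∧
        OrdNat.infNatProd α =
          Ordinal.omega0 ^ OrdNat.finNatSum (fun i => OrdNat.degree (α i)) n *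
            OrdNat.infProd (OrdNat.tail α n)) := by
  by_cases hα : ∃ i, α i = 0
  · obtain ⟨i, hi⟩ := hα
    obtain ⟨m, hm⟩ := OrdNat.exists_infNatProd_tail_eq_infProd α
    -- From `i + 1` on, the zero factor lies in the initial product, so both sides vanish whatever
    -- the tail is.
    refine ⟨max m (i + 1), fun n hn => ⟨hm n (le_of_max_le_left hn), ?_, ?_, fun h => absurd hi (h i)⟩⟩
    all_goals rw [OrdNat.infNatProd_eq_zero hi,
      OrdNat.finNatProd_eq_zero hi (le_of_max_le_right hn), zero_mul]
  · rw [not_exists] at hα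
    by_cases hone : ∀ᶠ i in Filter.atTop, α i = 1
    · obtain ⟨m, hm⟩ := OrdNat.exists_infNatProd_tail hα
      refine ⟨m, fun n hn => ?_⟩
      obtain ⟨h₁, h₂⟩ := hm n hn
      exact ⟨h₁, h₂, h₁ ▸ h₂, fun _ h => absurd hone h⟩
    · obtain ⟨e, m, hm⟩ := OrdNat.exists_infNatProd_eq hα hone
      refine ⟨m, fun n hn => ?_⟩
      obtain ⟨h₁, h₂, h₃, h₄⟩ := hm n hn
      rw [h₁, h₂]
      exact ⟨rfl, h₃, h₃, fun _ _ => ⟨h₄, h₄⟩⟩
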